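/- Let $L^2=L^2(S^1,d\theta/2\pi)$ be the complex Hilbert space on the circle $S^1=\mathbb R/2\pi\mathbb Z$, and let $D=\partial_\theta$. For a real weight $w\in W^{1,\infty}(S^1)$ with $0<w_-\le w\le w_+<\infty$ a.e. and for $\lambda\ge 0$ put $$\langle f,g\rangle_{w,\lambda}=\int f\,\overline g\,w\,\frac{d\theta}{2\pi}+\lambda\int f'\,\overline{g'}\,\frac{d\theta}{2\pi}.$$ Let $H_{w,\lambda}\subset L^2$ be the Hilbert completion of the trigonometric polynomials for this inner product (so $H_{w,0}=L^2$ with the weighted inner product, and $H_{w,\lambda}=H^1(S^1)$ for $\lambda>0$), let $D^*_{w,\lambda}$ be the adjoint in $H_{w,\lambda}$ of the closed operator $D$ in $H_{w,\lambda}$, and let $\Delta_{w,\lambda}=D^*_{w,\lambda}D$ be the associated Laplacian. On trigonometric polynomials $\Delta_{w,\lambda}=A_{w,\lambda}^{-1}(-\partial_\theta)A_{w,\lambda}\,\partial_\theta$ with $A_{w,\lambda}f=wf-\lambda f''$. For every $\lambda\ge 0$ the operator $\Delta_{w,\lambda}$, regarded as an unbounded operator in $L^2$, is closable, and $1+\Delta_{w,\lambda}$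 (with $\Delta_{w,\lambda}$ now denoting the closure in $L^2$) has a bounded, everywhere defined inverse on $L^2$. There is a function $C=C(w_-,w_+,\|w'\|_{L^\infty})$, depending on these three numbers only, such that for all such $w$ and every $\lambda>0$ $$\big\|(1+\Delta_{w,\lambda})^{-1}-(1+\Delta_{w,0})^{-1}\big\|_{\mathcal B(L^2)}\le C(w_-,w_+,\|w'\|_{L^\infty})\,\lambda .$$ -/

import Mathlib

open MeasureTheory ComplexConjugate
open scoped ENNReal

namespace CircleGeometry

instance fact_two_pi_pos : Fact (0 < 2 * Real.pi) := ⟨Real.two_pi_pos⟩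

/-- The circle `S¹ = ℝ / 2πℤ`. -/
abbrev S1 : Type := AddCircle (2 * Real.pi)

/-- The normalised measure `dθ / 2π` on the circle. -/
noncomputable abbrev μ : Measure S1 := AddCircle.haarAddCircle

/-- The fixed complex Hilbert space `L²(S¹, dθ/2π)`. -/
abbrev L2 : Type := Lp ℂ 2 μ

/-- `g` is the weak derivative `∂_θ f`: for every character `e_n(θ) = e^{inθ}` one has
`∫ g e_{-n} = - ∫ f (e_{-n})'`, that is, `ĝ(n) = i n f̂(n)`. -/
def IsWeakDeriv (f g : S1 → ℂ) : Prop :=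
  ∀ n : ℤ, fourierCoeff g n = Complex.I * (n : ℂ) * fourierCoeff f n

/-- `w ∈ W^{1,∞}(S¹)` (real-valued), with weak derivative `w'`. -/
structure IsW1Infty (w w' : S1 → ℝ) : Prop where
  memLp : MemLp w ∞ μ
  memLp_deriv : MemLp w' ∞ μ
  isWeakDeriv : IsWeakDeriv (fun θ => (w θ : ℂ)) (fun θ => (w' θ : ℂ))

/-- The Sobolev space `H¹(S¹) = {f ∈ L² : ∂_θ f ∈ L²}`. -/
def H1 : Set L2 := {f | ∃ g : L2, IsWeakDeriv f g}

open Classical in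
/-- `D f = ∂_θ f` for `f ∈ H¹(S¹)` (and `0` for other `f`; this value is never relevant). -/
noncomputable def D (f : L2) : L2 :=
  if h : ∃ g : L2, IsWeakDeriv f g then h.choose else 0

theorem isWeakDeriv_unique {f g h : L2} (hg : IsWeakDeriv f g) (hh : IsWeakDeriv f h) :
    g = h := by
  apply (fourierBasis (T := 2 * Real.pi)).repr.injective
  ext n
  rw [fourierBasis_repr, fourierBasis_repr, hg n, hh n]

theorem isWeakDeriv_D {f : L2} (hf : f ∈ H1) : IsWeakDeriv f (D f) := by
  have h : ∃ g : L2, IsWeakDeriv f g := hf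
  rw [D, dif_pos h]
  exact h.choose_spec

theorem D_eq {f g : L2} (h : IsWeakDeriv f g) : D f = g :=
  isWeakDeriv_unique (isWeakDeriv_D ⟨g, h⟩) h

/-- The inner product
`⟨f, g⟩_{w,lam} = ∫ f ḡ w dθ/2π + lam ∫ f' ḡ' dθ/2π`.
For `lam = 0` it is the weighted inner product `⟨f, g⟩_w`. -/
noncomputable def geomInner (w : S1 → ℝ) (lam : ℝ) (f g : L2) : ℂ :=
  (∫ θ, f θ * conj (g θ) * (w θ : ℂ) ∂μ) + (lam : ℂ) * ∫ θ, D f θ * conj (D g θ) ∂μ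

open Classical in
/-- The Hilbert completion of the trigonometric polynomials for `⟨·,·⟩_{w,lam}`, realised inside
`L²`, for a weight bounded above and away from `0`: all of `L²` if `lam = 0`,
and `H¹` if `lam > 0`. -/
noncomputable def geomSpace (lam : ℝ) : Set L2 :=
  if lam = 0 then Set.univ else H1

/-- The domain of (the closure of) the derivation `D = ∂_θ` in the Hilbert space
`geomSpace lam`: those `u` with `u ∈ geomSpace lam` and `u' ∈ geomSpace lam`. -/
def derivationDomain (lam : ℝ) : Set L2 :=
  {u | u ∈ geomSpace lam ∧ u ∈ H1 ∧ D u ∈ geomSpace lam}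

/-- The graph of the Hilbert adjoint `D*` of the derivation, with respect to `⟨·,·⟩_{w,lam}`. -/
def adjointGraph (w : S1 → ℝ) (lam : ℝ) : Set (L2 × L2) :=
  {p | p.1 ∈ geomSpace lam ∧ p.2 ∈ geomSpace lam ∧
    ∀ v ∈ derivationDomain lam, geomInner w lam (D v) p.1 = geomInner w lam v p.2}

/-- The graph of the Laplacian `Δ_{w,lam} = D* D`, the adjoint being that
of the geometry `⟨·,·⟩_{w,lam}`. -/
def laplacianGraph (w : S1 → ℝ) (lam : ℝ) : Set (L2 × L2) :=
  {p | p.1 ∈ derivationDomain lam ∧ (D p.1, p.2) ∈ adjointGraph w lam}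

/-- `R = (1 + T)⁻¹` as a bounded operator on `L²`, where `T` is an unbounded linear operator in
`L²`, given by its graph: `T` is closable in `L²`, and `R` is the everywhere defined inverse
of `1 + T`, with `T` standing for its closure, i.e. `R f = u` if and only if
`u ∈ Dom T` and `u + T u = f`. -/
structure IsResolvent (T : Set (L2 × L2)) (R : L2 →L[ℂ] L2) : Prop where
  closable : ∀ h : L2, ((0 : L2), h) ∈ closure T → h = 0
  apply_eq_iff : ∀ f u : L2, R f = u ↔ (u, f - u) ∈ closure T

end CircleGeometry

/-
Let `W` be multiplication by `w`, let `W' = [D, W]` be multiplication by `w'`, and put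
`L_lam = W - D W D - lam D² + lam D⁴`. On smooth functions `A_{w,lam} (1 + Δ_{w,lam}) = L_lam`, so
that `R_lam := (1 + Δ_{w,lam})⁻¹ = L_lam⁻¹ (W - lam D²)` and `R_0 = L_0⁻¹ W`. As
`L_lam = L_0 - lam D² + lam D⁴`, the resolvents satisfy
`R_lam - R_0 = -lam L_lam⁻¹ D² (1 - R_0 + D² R_0) = lam (D² L_lam⁻¹)* W⁻¹ W' D R_0`,
where the equation for `R_0` has been used in the form `W (1 - R_0 + D² R_0) = -W' D R_0`. The
factor `D R_0` is bounded by the energy estimate. The factor `D² L_lam⁻¹` is bounded uniformly in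
`lam`: pairing `L_lam φ = h` with `φ''`, the term `lam ⟪φ'', D² φ''⟫` has the favourable sign, and
`D W D φ = W' φ' + W φ''` controls `φ''` by the energy estimate for `φ` and `φ'`.
-/

namespace CircleGeometry

open scoped InnerProductSpace

theorem mul_le_of_mul_sq_le {c a x : ℝ} (ha : 0 ≤ a) (hx : 0 ≤ x) (h : c * a ^ 2 ≤ a * x) :
    c * a ≤ x := by
  rcases ha.eq_or_lt with rfl | ha
  · simpa using hx
  · exact le_of_mul_le_mul_left (by linarith) ha

theorem mul_le_of_energy {c a b x : ℝ} (hc : 0 < c) (ha : 0 ≤ a) (hx : 0 ≤ x)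
    (h : c * (a ^ 2 + b ^ 2) ≤ a * x) : c * a ≤ x ∧ c * b ≤ x := by
  have hca : c * a ≤ x := by
    refine mul_le_of_mul_sq_le ha hx (le_trans ?_ h)
    gcongr
    exact le_add_of_nonneg_right (sq_nonneg b)
  refine ⟨hca, (abs_le_of_sq_le_sq' ?_ hx).2⟩
  calc (c * b) ^ 2 ≤ c * (c * (a ^ 2 + b ^ 2)) := by linarith [sq_nonneg (c * a)]
    _ ≤ c * (a * x) := by gcongr
    _ = c * a * x := (mul_assoc _ _ _).symm
    _ ≤ x ^ 2 := by rw [sq]; gcongr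

section Coercive

variable {𝕜 E : Type*} [RCLike 𝕜] [NormedAddCommGroup E] [InnerProductSpace 𝕜 E]
  {T S : E →L[𝕜] E} {c d : ℝ}

/-- The operator `T` has real part at least `c`. This lower bound is the only form in which
positivity of a weight enters the abstract argument. -/
def CoerciveWith (T : E →L[𝕜] E) (c : ℝ) : Prop :=
  ∀ x, c * ‖x‖ ^ 2 ≤ RCLike.re ⟪x, T x⟫_𝕜

theorem CoerciveWith.mul_norm_le (hT : CoerciveWith T c) (x : E) : c * ‖x‖ ≤ ‖T x‖ :=
  mul_le_of_mul_sq_le (norm_nonneg _) (norm_nonneg _) ((hT x).trans (re_inner_le_norm x (T x)))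

theorem CoerciveWith.eq_zero (hT : CoerciveWith T c) (hc : 0 < c) {x : E}
    (hx : RCLike.re ⟪x, T x⟫_𝕜 ≤ 0) : x = 0 := by
  have := (hT x).trans hx
  by_contra hne
  have := norm_pos_iff.2 hne
  have : 0 < c * ‖x‖ ^ 2 := by positivity
  linarith

theorem CoerciveWith.injective (hT : CoerciveWith T c) (hc : 0 < c) : Function.Injective T :=
  (injective_iff_map_eq_zero T).2 fun x hx => hT.eq_zero hc (by simp [hx])

theorem CoerciveWith.mono (hT : CoerciveWith T c) (hd : d ≤ c) : CoerciveWith T d :=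
  fun x => (mul_le_mul_of_nonneg_right hd (sq_nonneg _)).trans (hT x)

theorem CoerciveWith.add (hT : CoerciveWith T c) (hS : CoerciveWith S d) :
    CoerciveWith (T + S) (c + d) := fun x => by
  simpa only [add_mul, add_apply, inner_add_right, map_add] using add_le_add (hT x) (hS x)

theorem coerciveWith_smul_one (c : ℝ) : CoerciveWith ((c : 𝕜) • (1 : E →L[𝕜] E)) c := fun x => by
  simp [inner_smul_right]

theorem exists_laxMilgram (K : Submodule 𝕜 E) [CompleteSpace K] (hc : 0 < c)
    (hT : ∀ x ∈ K, c * ‖x‖ ^ 2 ≤ RCLike.re ⟪x, T x⟫_𝕜) :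
    ∃ Q : E →L[𝕜] E, ∀ y, Q y ∈ K ∧ ∀ v ∈ K, ⟪v, T (Q y)⟫_𝕜 = ⟪v, y⟫_𝕜 := by
  set P := K.orthogonalProjectionOnto
  have hP (v : K) (y : E) : ⟪v, P y⟫_𝕜 = ⟪(v : E), y⟫_𝕜 :=
    K.inner_orthogonalProjectionOnto_eq_of_mem_left v y
  have hunit : IsUnit (P ∘L T ∘L K.subtypeL) := by
    refine ContinuousLinearMap.isUnit_of_forall_le_norm_inner_map (c := ⟨c, hc.le⟩) _ hc
      fun x => ?_
    rw [norm_inner_symm]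
    calc ‖x‖ ^ 2 * c = c * ‖(x : E)‖ ^ 2 := mul_comm _ _
      _ ≤ RCLike.re ⟪(x : E), T x⟫_𝕜 := hT x x.2
      _ = RCLike.re ⟪x, P (T x)⟫_𝕜 := by rw [hP]
      _ ≤ ‖⟪x, P (T x)⟫_𝕜‖ := RCLike.re_le_norm _
  obtain ⟨A, hA⟩ := hunit.exists_right_inv
  refine ⟨K.subtypeL ∘L A ∘L P, fun y => ⟨(A (P y)).2, fun v hv => ?_⟩⟩
  have h : P (T (A (P y))) = P y := DFunLike.congr_fun hA (P y)
  rw [← hP ⟨v, hv⟩ y, ← h, hP]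
  rfl

end Coercive

section ProductOperators

variable {𝕜 E H ι : Type*} [RCLike 𝕜] [NormedAddCommGroup E] [NormedSpace 𝕜 E]
  [NormedAddCommGroup H] [InnerProductSpace 𝕜 H]

/-- The operator `x ↦ (T i x)_i` into the Hilbert direct sum of copies of `H`. It assembles the
sources and the block operators of variational problems on jets. -/
noncomputable def piOp (T : ι → E →L[𝕜] H) : E →L[𝕜] PiLp 2 fun _ : ι => H :=
  (PiLp.continuousLinearEquiv 2 𝕜 fun _ : ι => H).symm ∘L ContinuousLinearMap.pi T

@[simp]
theorem piOp_apply (T : ι → E →L[𝕜] H) (x : E) (i : ι) : piOp T x i = T i x :=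
  rfl

variable [Fintype ι]

/-- The diagonal operator `(x_i)_i ↦ (T i x_i)_i`: the energy form of an operator in divergence
form, acting on jets. -/
noncomputable def diagOp (T : ι → H →L[𝕜] H) :
    (PiLp 2 fun _ : ι => H) →L[𝕜] PiLp 2 fun _ : ι => H :=
  piOp fun i => T i ∘L PiLp.proj 2 _ i

@[simp]
theorem diagOp_apply (T : ι → H →L[𝕜] H) (x : PiLp 2 fun _ : ι => H) (i : ι) :
    diagOp T x i = T i (x i) :=
  rfl

theorem coerciveWith_diagOp {T : ι → H →L[𝕜] H} {c : ℝ} (hT : ∀ i, CoerciveWith (T i) c) :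
    CoerciveWith (diagOp T) c := fun x => by
  rw [PiLp.norm_sq_eq_of_L2, PiLp.inner_apply, Finset.mul_sum, map_sum]
  exact Finset.sum_le_sum fun i _ => hT i (x i)

end ProductOperators

section SkewAdjoint

variable {𝕜 H : Type*} [RCLike 𝕜] [NormedAddCommGroup H] [InnerProductSpace 𝕜 H]
  {𝒟 : Submodule 𝕜 (H × H)}

/-- The relation `𝒟` is the graph of a densely defined operator `D` with `D* = -D`. Working with
graphs keeps track of domains without partial functions: `(u, u') ∈ 𝒟` reads `D u = u'`. -/
structure IsSkewAdjoint (𝒟 : Submodule 𝕜 (H × H)) : Prop where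
  dense_domain : Dense {u : H | ∃ u', (u, u') ∈ 𝒟}
  mem_iff : ∀ a b : H, (a, b) ∈ 𝒟 ↔ ∀ v v', (v, v') ∈ 𝒟 → ⟪v', a⟫_𝕜 = -⟪v, b⟫_𝕜

namespace IsSkewAdjoint

theorem inner_eq_neg (h𝒟 : IsSkewAdjoint 𝒟) {u u' v v' : H} (hv : (v, v') ∈ 𝒟)
    (hu : (u, u') ∈ 𝒟) : ⟪v', u⟫_𝕜 = -⟪v, u'⟫_𝕜 :=
  (h𝒟.mem_iff u u').1 hu v v' hv

theorem eq_zero_of_mem (h𝒟 : IsSkewAdjoint 𝒟) {b : H} (hb : (0, b) ∈ 𝒟) : b = 0 :=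
  h𝒟.dense_domain.eq_zero_of_inner_right 𝕜 fun v ⟨_, hv⟩ => by
    simpa using (h𝒟.inner_eq_neg hv hb).symm

theorem unique (h𝒟 : IsSkewAdjoint 𝒟) {a b b' : H} (hb : (a, b) ∈ 𝒟) (hb' : (a, b') ∈ 𝒟) :
    b = b' :=
  sub_eq_zero.1 (h𝒟.eq_zero_of_mem (by simpa using 𝒟.sub_mem hb hb'))

theorem isClosed (h𝒟 : IsSkewAdjoint 𝒟) : IsClosed (𝒟 : Set (H × H)) := by
  have : (𝒟 : Set (H × H)) =
      ⋂ (v) (v') (_ : (v, v') ∈ 𝒟), {p | ⟪v', p.1⟫_𝕜 = -⟪v, p.2⟫_𝕜} := by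
    ext ⟨a, b⟩
    simpa using h𝒟.mem_iff a b
  rw [this]
  exact isClosed_iInter fun _ => isClosed_iInter fun _ => isClosed_iInter fun _ =>
    isClosed_eq (by fun_prop) (by fun_prop)

end IsSkewAdjoint

/-- The space of jets `(u, D u, …, Dⁿ u)`: the domain of `Dⁿ` with its graph norm, as a subspace of
a Hilbert direct sum. Variational problems are solved on it. -/
def jets (𝒟 : Submodule 𝕜 (H × H)) (n : ℕ) : Submodule 𝕜 (PiLp 2 fun _ : Fin (n + 1) => H) where
  carrier := {x | ∀ i : Fin n, (x i.castSucc, x i.succ) ∈ 𝒟}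
  add_mem' hx hy i := 𝒟.add_mem (hx i) (hy i)
  zero_mem' _ := 𝒟.zero_mem
  smul_mem' c _ hx i := 𝒟.smul_mem c (hx i)

theorem toLp_mem_jets_one {u u' : H} :
    WithLp.toLp 2 ![u, u'] ∈ jets 𝒟 1 ↔ (u, u') ∈ 𝒟 :=
  Fin.forall_fin_one

theorem toLp_mem_jets_two {u u' u'' : H} :
    WithLp.toLp 2 ![u, u', u''] ∈ jets 𝒟 2 ↔ (u, u') ∈ 𝒟 ∧ (u', u'') ∈ 𝒟 :=
  Fin.forall_fin_two

theorem IsSkewAdjoint.isClosed_jets (h𝒟 : IsSkewAdjoint 𝒟) (n : ℕ) :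
    IsClosed (jets 𝒟 n : Set (PiLp 2 fun _ : Fin (n + 1) => H)) := by
  have : (jets 𝒟 n : Set (PiLp 2 fun _ : Fin (n + 1) => H)) =
      ⋂ i : Fin n, (fun x => (x i.castSucc, x i.succ)) ⁻¹' 𝒟 := by
    ext x
    simp only [Set.mem_iInter, Set.mem_preimage]
    rfl
  rw [this]
  exact isClosed_iInter fun i => h𝒟.isClosed.preimage (by fun_prop)

end SkewAdjoint

section BoundaryValueProblems

variable {𝕜 H : Type*} [RCLike 𝕜] [NormedAddCommGroup H] [InnerProductSpace 𝕜 H]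
  {𝒟 : Submodule 𝕜 (H × H)} {T₀ T₁ W : H →L[𝕜] H} {c lam : ℝ}

/-- `u`, with derivative `u'`, solves the Sturm–Liouville equation `T₀ u - D T₁ D u = h`. -/
structure IsSturmLiouvilleSol (𝒟 : Submodule 𝕜 (H × H)) (T₀ T₁ : H →L[𝕜] H) (u u' h : H) :
    Prop where
  mem : (u, u') ∈ 𝒟
  mem_flux : (T₁ u', T₀ u - h) ∈ 𝒟

theorem IsSturmLiouvilleSol.energy (h𝒟 : IsSkewAdjoint 𝒟) (hT₀ : CoerciveWith T₀ c)
    (hT₁ : CoerciveWith T₁ c) {u u' h : H} (hu : IsSturmLiouvilleSol 𝒟 T₀ T₁ u u' h) :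
    c * (‖u‖ ^ 2 + ‖u'‖ ^ 2) ≤ ‖u‖ * ‖h‖ := by
  have henergy : ⟪u, T₀ u⟫_𝕜 + ⟪u', T₁ u'⟫_𝕜 = ⟪u, h⟫_𝕜 := by
    rw [h𝒟.inner_eq_neg hu.mem hu.mem_flux, inner_sub_right]
    ring
  calc c * (‖u‖ ^ 2 + ‖u'‖ ^ 2) = c * ‖u‖ ^ 2 + c * ‖u'‖ ^ 2 := mul_add _ _ _
    _ ≤ RCLike.re ⟪u, T₀ u⟫_𝕜 + RCLike.re ⟪u', T₁ u'⟫_𝕜 := add_le_add (hT₀ u) (hT₁ u')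
    _ = RCLike.re ⟪u, h⟫_𝕜 := by rw [← map_add, henergy]
    _ ≤ ‖u‖ * ‖h‖ := re_inner_le_norm u h

theorem IsSturmLiouvilleSol.unique (h𝒟 : IsSkewAdjoint 𝒟) (hc : 0 < c) (hT₀ : CoerciveWith T₀ c)
    (hT₁ : CoerciveWith T₁ c) {u u' v v' h : H} (hu : IsSturmLiouvilleSol 𝒟 T₀ T₁ u u' h)
    (hv : IsSturmLiouvilleSol 𝒟 T₀ T₁ v v' h) : u = v := by
  have hsub : IsSturmLiouvilleSol 𝒟 T₀ T₁ (u - v) (u' - v') 0 :=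
    ⟨𝒟.sub_mem hu.mem hv.mem, by simpa using 𝒟.sub_mem hu.mem_flux hv.mem_flux⟩
  have hle := (mul_le_of_energy hc (norm_nonneg _) (norm_nonneg _) (hsub.energy h𝒟 hT₀ hT₁)).1
  exact sub_eq_zero.1 (norm_le_zero_iff.1 (nonpos_of_mul_nonpos_right (by simpa using hle) hc))

theorem exists_isSturmLiouvilleSol [CompleteSpace H] (h𝒟 : IsSkewAdjoint 𝒟) (hc : 0 < c)
    (hT₀ : CoerciveWith T₀ c) (hT₁ : CoerciveWith T₁ c) :
    ∃ A : H →L[𝕜] H, ∀ h, ∃ u', IsSturmLiouvilleSol 𝒟 T₀ T₁ (A h) u' h := by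
  have : CompleteSpace (jets 𝒟 1) := (h𝒟.isClosed_jets 1).completeSpace_coe
  have hT : CoerciveWith (diagOp ![T₀, T₁]) c :=
    coerciveWith_diagOp (Fin.forall_fin_two.2 ⟨hT₀, hT₁⟩)
  obtain ⟨Q, hQ⟩ := exists_laxMilgram (jets 𝒟 1) hc fun x _ => hT x
  refine ⟨PiLp.proj 2 _ 0 ∘L Q ∘L piOp ![1, 0], fun h => ?_⟩
  obtain ⟨hmem, hweak⟩ := hQ (piOp (𝕜 := 𝕜) ![1, 0] h)
  refine ⟨_, hmem 0, (h𝒟.mem_iff _ _).2 fun v v' hv => ?_⟩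
  have := hweak _ (toLp_mem_jets_one.2 hv)
  simp only [PiLp.inner_apply, Fin.sum_univ_two, diagOp_apply, piOp_apply, Matrix.cons_val_zero,
    Matrix.cons_val_one, one_apply_eq_self, zero_apply, inner_zero_right, add_zero] at this
  rw [inner_sub_right, ← this]
  simp

theorem exists_jet_sub_smul_eq [CompleteSpace H] (h𝒟 : IsSkewAdjoint 𝒟) (hc : 0 < c)
    (hT : CoerciveWith T₀ c) (hlam : 0 < lam) (h : H) :
    ∃ v v' v'', (v, v') ∈ 𝒟 ∧ (v', v'') ∈ 𝒟 ∧ T₀ v - (lam : 𝕜) • v'' = h := by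
  obtain ⟨A, hA⟩ := exists_isSturmLiouvilleSol h𝒟 (lt_min hc hlam)
    (hT.mono (min_le_left _ _)) ((coerciveWith_smul_one (𝕜 := 𝕜) lam).mono (min_le_right _ _))
  have hlam' : (lam : 𝕜) ≠ 0 := RCLike.ofReal_ne_zero.2 hlam.ne'
  obtain ⟨u', hu⟩ := hA h
  refine ⟨A h, u', (lam : 𝕜)⁻¹ • (T₀ (A h) - h), hu.mem, ?_, ?_⟩
  · have := 𝒟.smul_mem (lam : 𝕜)⁻¹ hu.mem_flux
    simpa [inv_smul_smul₀ hlam'] using this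
  · rw [smul_inv_smul₀ hlam', sub_sub_cancel]

/-- `D²` is self-adjoint: a vector on which the adjoint of `D²` is defined has two derivatives. -/
theorem IsSkewAdjoint.exists_jet_of_inner_eq [CompleteSpace H] (h𝒟 : IsSkewAdjoint 𝒟) {a h : H}
    (hah : ∀ v v' v'', (v, v') ∈ 𝒟 → (v', v'') ∈ 𝒟 → ⟪v'', a⟫_𝕜 = ⟪v, h⟫_𝕜) :
    ∃ b, (a, b) ∈ 𝒟 ∧ (b, h) ∈ 𝒟 := by
  have hone : CoerciveWith (1 : H →L[𝕜] H) 1 := by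
    simpa using coerciveWith_smul_one (𝕜 := 𝕜) (E := H) 1
  have hsurj := exists_jet_sub_smul_eq h𝒟 one_pos hone one_pos
  simp only [RCLike.ofReal_one, one_smul, one_apply_eq_self] at hsurj
  obtain ⟨y, y', y'', hy, hy', hyah⟩ := hsurj (a - h)
  obtain ⟨v, v', v'', hv, hv', hvay⟩ := hsurj (a - y)
  have hzero : ⟪a - y, a - y⟫_𝕜 = 0 := by
    have hvy : ⟪v'', y⟫_𝕜 = ⟪v, y''⟫_𝕜 := by
      rw [h𝒟.inner_eq_neg hv' hy, h𝒟.inner_eq_neg hv hy', neg_neg]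
    calc ⟪a - y, a - y⟫_𝕜 = ⟪v - v'', a - y⟫_𝕜 := by rw [hvay]
      _ = ⟪v, (a - h) - (y - y'')⟫_𝕜 := by
        simp only [inner_sub_left, inner_sub_right, hah v v' v'' hv hv', hvy]
      _ = 0 := by rw [hyah, sub_self, inner_zero_right]
  obtain rfl : a = y := sub_eq_zero.1 (inner_self_eq_zero.1 hzero)
  obtain rfl : y'' = h := sub_right_injective hyah
  exact ⟨y', hy, hy'⟩

/-- The triple `(u, u', u'')` is the jet of a weak solution of `L_lam u = h + D² k`, where
`L_lam = W - D W D - lam D² + lam D⁴`. In `weak` at most two derivatives fall on `u`, so that no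
regularity beyond the domain of `D²` is presupposed. -/
structure IsWeakSol (𝒟 : Submodule 𝕜 (H × H)) (W : H →L[𝕜] H) (lam : ℝ) (u u' u'' h k : H) :
    Prop where
  mem : (u, u') ∈ 𝒟
  mem' : (u', u'') ∈ 𝒟
  weak : ∀ v v' v'', (v, v') ∈ 𝒟 → (v', v'') ∈ 𝒟 →
    ⟪v, W u⟫_𝕜 + ⟪v', W u'⟫_𝕜 + lam * ⟪v', u'⟫_𝕜 + lam * ⟪v'', u''⟫_𝕜 = ⟪v, h⟫_𝕜 + ⟪v'', k⟫_𝕜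

theorem exists_isWeakSol [CompleteSpace H] (h𝒟 : IsSkewAdjoint 𝒟) (hc : 0 < c)
    (hW : CoerciveWith W c) (hlam : 0 < lam) (S T : H →L[𝕜] H) :
    ∃ U : H →L[𝕜] H, ∀ f, ∃ u' u'', IsWeakSol 𝒟 W lam (U f) u' u'' (S f) (T f) := by
  have : CompleteSpace (jets 𝒟 2) := (h𝒟.isClosed_jets 2).completeSpace_coe
  have hlam_one := coerciveWith_smul_one (𝕜 := 𝕜) (E := H) lam
  have hB : CoerciveWith (diagOp ![W, W + (lam : 𝕜) • 1, (lam : 𝕜) • 1]) (min c lam) := by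
    refine coerciveWith_diagOp (Fin.forall_fin_succ.2 ⟨?_, Fin.forall_fin_two.2 ⟨?_, ?_⟩⟩)
    · exact hW.mono (min_le_left _ _)
    · exact (hW.add hlam_one).mono ((min_le_left _ _).trans (le_add_of_nonneg_right hlam.le))
    · exact hlam_one.mono (min_le_right _ _)
  obtain ⟨Q, hQ⟩ := exists_laxMilgram (jets 𝒟 2) (lt_min hc hlam) fun x _ => hB x
  refine ⟨PiLp.proj 2 _ 0 ∘L Q ∘L piOp ![S, 0, T], fun f => ?_⟩
  obtain ⟨hmem, hweak⟩ := hQ (piOp ![S, 0, T] f)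
  refine ⟨_, _, hmem 0, hmem 1, fun v v' v'' hv hv' => ?_⟩
  have := hweak _ (toLp_mem_jets_two.2 ⟨hv, hv'⟩)
  simp only [PiLp.inner_apply, Fin.sum_univ_three, diagOp_apply, piOp_apply, Matrix.cons_val,
    add_apply, smul_apply, one_apply_eq_self, zero_apply, inner_add_right, inner_smul_right,
    inner_zero_right, add_zero, ← add_assoc] at this
  exact this

namespace IsWeakSol

variable {u u' u'' v v' v'' h h₁ k k₁ : H}

theorem sub (hu : IsWeakSol 𝒟 W lam u u' u'' h k) (hv : IsWeakSol 𝒟 W lam v v' v'' h₁ k₁) :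
    IsWeakSol 𝒟 W lam (u - v) (u' - v') (u'' - v'') (h - h₁) (k - k₁) where
  mem := 𝒟.sub_mem hu.mem hv.mem
  mem' := 𝒟.sub_mem hu.mem' hv.mem'
  weak x x' x'' hx hx' := by
    simp only [map_sub, inner_sub_right]
    linear_combination hu.weak x x' x'' hx hx' - hv.weak x x' x'' hx hx'

theorem energy (hW : CoerciveWith W c) (hlam : 0 ≤ lam) (hu : IsWeakSol 𝒟 W lam u u' u'' h 0) :
    c * (‖u‖ ^ 2 + ‖u'‖ ^ 2) ≤ ‖u‖ * ‖h‖ := by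
  have henergy := congrArg RCLike.re (hu.weak u u' u'' hu.mem hu.mem')
  simp only [map_add, RCLike.re_ofReal_mul, inner_self_eq_norm_sq, inner_zero_right, add_zero]
    at henergy
  calc c * (‖u‖ ^ 2 + ‖u'‖ ^ 2) = c * ‖u‖ ^ 2 + c * ‖u'‖ ^ 2 := mul_add _ _ _
    _ ≤ RCLike.re ⟪u, W u⟫_𝕜 + RCLike.re ⟪u', W u'⟫_𝕜 := add_le_add (hW u) (hW u')
    _ ≤ RCLike.re ⟪u, h⟫_𝕜 := by
      rw [← henergy]
      linarith [mul_nonneg hlam (sq_nonneg ‖u'‖), mul_nonneg hlam (sq_nonneg ‖u''‖)]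
    _ ≤ ‖u‖ * ‖h‖ := re_inner_le_norm u h

theorem unique (hc : 0 < c) (hW : CoerciveWith W c) (hlam : 0 ≤ lam)
    (hu : IsWeakSol 𝒟 W lam u u' u'' h k)
    (hv : IsWeakSol 𝒟 W lam v v' v'' h k) : u = v := by
  have hsub := hu.sub hv
  rw [sub_self, sub_self] at hsub
  have hle := (mul_le_of_energy hc (norm_nonneg _) (norm_nonneg _) (hsub.energy hW hlam)).1
  exact sub_eq_zero.1 (norm_le_zero_iff.1 (nonpos_of_mul_nonpos_right (by simpa using hle) hc))

theorem source_eq_zero [CompleteSpace H] (h𝒟 : IsSkewAdjoint 𝒟) (hc : 0 < c)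
    (hW : CoerciveWith W c) (hsymm : (W : H →ₗ[𝕜] H).IsSymmetric) (hlam : 0 < lam)
    {f : H} (hu : IsWeakSol 𝒟 W lam 0 u' u'' (W f) (-(lam : 𝕜) • f)) : f = 0 := by
  obtain rfl : u' = 0 := h𝒟.eq_zero_of_mem hu.mem
  obtain rfl : u'' = 0 := h𝒟.eq_zero_of_mem hu.mem'
  obtain ⟨v, v', v'', hv, hv', hvf⟩ := exists_jet_sub_smul_eq h𝒟 hc hW hlam f
  have hzero : ⟪W v - (lam : 𝕜) • v'', f⟫_𝕜 = 0 := by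
    have hweak := hu.weak v v' v'' hv hv'
    have hsymm' : ⟪W v, f⟫_𝕜 = ⟪v, W f⟫_𝕜 := hsymm v f
    simp only [map_zero, inner_zero_right, mul_zero, add_zero, inner_smul_right] at hweak
    rw [inner_sub_left, inner_smul_left, RCLike.conj_ofReal, hsymm']
    linear_combination -hweak
  rwa [hvf, inner_self_eq_zero] at hzero

end IsWeakSol

end BoundaryValueProblems

section Commutator

variable {𝕜 H : Type*} [RCLike 𝕜] [NormedAddCommGroup H] [InnerProductSpace 𝕜 H]
  {𝒟 : Submodule 𝕜 (H × H)} {W W' : H →L[𝕜] H} {c : ℝ}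

/-- The commutator `[D, W]` is the bounded operator `W'`. For multiplication by a function `w`
this is the Leibniz rule, and `W'` is multiplication by the derivative of `w`. -/
def HasCommutator (𝒟 : Submodule 𝕜 (H × H)) (W W' : H →L[𝕜] H) : Prop :=
  ∀ v v', (v, v') ∈ 𝒟 → (W v, W' v + W v') ∈ 𝒟

theorem CoerciveWith.exists_coerciveWith_triangular (hW : CoerciveWith W c) (hc : 0 < c)
    (W' : H →L[𝕜] H) :
    ∃ κ : ℝ, 0 < κ ∧ CoerciveWith (piOp ![(κ : 𝕜) • W ∘L PiLp.proj 2 _ 0,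
      W' ∘L PiLp.proj 2 _ 0 + W ∘L PiLp.proj 2 (fun _ : Fin 2 => H) 1]) (c / 2) := by
  refine ⟨1 / 2 + ‖W'‖ ^ 2 / (2 * c ^ 2), by positivity, fun x => ?_⟩
  set κ : ℝ := 1 / 2 + ‖W'‖ ^ 2 / (2 * c ^ 2)
  have hcross : -(‖W'‖ * ‖x 0‖ * ‖x 1‖) ≤ RCLike.re ⟪x 1, W' (x 0)⟫_𝕜 := by
    refine (abs_le.1 ((RCLike.abs_re_le_norm _).trans ((norm_inner_le_norm _ _).trans ?_))).1
    calc ‖x 1‖ * ‖W' (x 0)‖ ≤ ‖x 1‖ * (‖W'‖ * ‖x 0‖) := by gcongr; exact W'.le_opNorm _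
      _ = ‖W'‖ * ‖x 0‖ * ‖x 1‖ := by ring
  have hκ : κ * c = c / 2 + ‖W'‖ ^ 2 / (2 * c) := by
    simp only [κ]; field_simp
  have hyoung : ‖W'‖ * ‖x 0‖ * ‖x 1‖ ≤ ‖W'‖ ^ 2 / (2 * c) * ‖x 0‖ ^ 2 + c / 2 * ‖x 1‖ ^ 2 := by
    have : 0 ≤ (‖W'‖ * ‖x 0‖ - c * ‖x 1‖) ^ 2 / (2 * c) := by positivity
    refine sub_nonneg.1 (this.trans_eq ?_)
    field_simp
    ring
  have hdiag : κ * c * ‖x 0‖ ^ 2 ≤ κ * RCLike.re ⟪x 0, W (x 0)⟫_𝕜 := by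
    rw [mul_assoc]
    exact mul_le_mul_of_nonneg_left (hW _) (by positivity)
  rw [PiLp.norm_sq_eq_of_L2, PiLp.inner_apply, Fin.sum_univ_two, Fin.sum_univ_two]
  simp only [piOp_apply, Matrix.cons_val_zero, Matrix.cons_val_one, smul_apply, add_apply,
    ContinuousLinearMap.comp_apply, PiLp.proj_apply, inner_smul_right, inner_add_right, map_add,
    RCLike.re_ofReal_mul]
  rw [hκ] at hdiag
  linarith [hW (x 1)]

/-- Lax–Milgram on the domain of `D` produces a `z` in it with `W z - W y` orthogonal to that
domain for a weighted graph inner product. -/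
theorem HasCommutator.exists_mem_of_map_mem [CompleteSpace H] (h𝒟 : IsSkewAdjoint 𝒟)
    (hcomm : HasCommutator 𝒟 W W') (hc : 0 < c) (hW : CoerciveWith W c) {y v' : H}
    (hv : (W y, v') ∈ 𝒟) : ∃ y', (y, y') ∈ 𝒟 := by
  have : CompleteSpace (jets 𝒟 1) := (h𝒟.isClosed_jets 1).completeSpace_coe
  obtain ⟨κ, hκ, hT⟩ := hW.exists_coerciveWith_triangular hc W'
  obtain ⟨Q, hQ⟩ := exists_laxMilgram (jets 𝒟 1) (half_pos hc) fun x _ => hT x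
  obtain ⟨hmem, hweak⟩ := hQ (WithLp.toLp 2 ![(κ : 𝕜) • W y, v'])
  set x := Q (WithLp.toLp 2 ![(κ : 𝕜) • W y, v'])
  have hx : (x 0, x 1) ∈ 𝒟 := hmem 0
  suffices hWx : W (x 0) - W y = 0 by
    rw [← hW.injective hc (sub_eq_zero.1 hWx)]
    exact ⟨_, hx⟩
  rw [← norm_eq_zero, ← pow_eq_zero_iff two_ne_zero]
  have hsub := 𝒟.sub_mem (hcomm _ _ hx) hv
  have horth := congrArg RCLike.re (hweak _ (toLp_mem_jets_one.2 hsub))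
  simp only [PiLp.inner_apply, Fin.sum_univ_two, piOp_apply, Matrix.cons_val_zero,
    Matrix.cons_val_one, smul_apply, add_apply, ContinuousLinearMap.comp_apply, PiLp.proj_apply,
    inner_smul_right] at horth
  have hsum : κ * ‖W (x 0) - W y‖ ^ 2 + ‖W' (x 0) + W (x 1) - v'‖ ^ 2 = 0 := by
    rw [← inner_self_eq_norm_sq (𝕜 := 𝕜) (W (x 0) - W y), ← inner_self_eq_norm_sq (𝕜 := 𝕜) (_ - v'),
      inner_sub_right _ (W (x 0)), inner_sub_right _ (_ + _)]
    simp only [map_add, map_sub, RCLike.re_ofReal_mul] at horth ⊢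
    linarith
  nlinarith [sq_nonneg ‖W (x 0) - W y‖, sq_nonneg ‖W' (x 0) + W (x 1) - v'‖]

end Commutator

section SingularPerturbation

variable {𝕜 H : Type*} [RCLike 𝕜] [NormedAddCommGroup H] [InnerProductSpace 𝕜 H]
  {𝒟 : Submodule 𝕜 (H × H)} {W W' : H →L[𝕜] H} {c lam : ℝ}

/-- The second-order expression `g = h - W u + D W D u + lam D² u` equals `lam D⁴ u`, hence its
inner product with `u''` is at most `0`; there `W u''` dominates, whatever `lam` is. -/
theorem IsWeakSol.sq_mul_norm_deriv_two_le [CompleteSpace H] (h𝒟 : IsSkewAdjoint 𝒟)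
    (hcomm : HasCommutator 𝒟 W W') (hc : 0 < c) (hW : CoerciveWith W c) (hlam : 0 < lam)
    {u u' u'' h : H} (hu : IsWeakSol 𝒟 W lam u u' u'' h 0) :
    c ^ 2 * ‖u''‖ ≤ (c + ‖W‖ + ‖W'‖) * ‖h‖ := by
  set g := h - W u + (W' u' + W u'') + (lam : 𝕜) • u''
  obtain ⟨b, hb, hbg⟩ : ∃ b, ((lam : 𝕜) • u'', b) ∈ 𝒟 ∧ (b, g) ∈ 𝒟 := by
    refine h𝒟.exists_jet_of_inner_eq fun v v' v'' hv hv' => ?_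
    have hweak := hu.weak v v' v'' hv hv'
    have hWu' := h𝒟.inner_eq_neg hv (hcomm u' u'' hu.mem')
    have hu'' := h𝒟.inner_eq_neg hv hu.mem'
    simp only [g, inner_smul_right, inner_add_right, inner_sub_right, inner_zero_right] at *
    linear_combination hweak - hWu' - lam * hu''
  have hnonpos : RCLike.re ⟪u'', g⟫_𝕜 ≤ 0 := by
    have hbb := congrArg RCLike.re (h𝒟.inner_eq_neg hb hbg)
    rw [inner_self_eq_norm_sq, inner_smul_left, RCLike.conj_ofReal, map_neg, RCLike.re_ofReal_mul]
      at hbb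
    exact nonpos_of_mul_nonpos_right (by linarith [sq_nonneg ‖b‖]) hlam
  have hle : c * ‖u''‖ ^ 2 ≤ ‖u''‖ * ‖W u - h - W' u'‖ := by
    refine (hW u'').trans (le_trans ?_ (re_inner_le_norm (𝕜 := 𝕜) _ _))
    simp only [g, inner_add_right, inner_sub_right, inner_smul_right, map_add, map_sub,
      RCLike.re_ofReal_mul, inner_self_eq_norm_sq] at hnonpos ⊢
    linarith [mul_nonneg hlam.le (sq_nonneg ‖u''‖)]
  obtain ⟨hu_le, hu'_le⟩ :=
    mul_le_of_energy hc (norm_nonneg _) (norm_nonneg _) (hu.energy hW hlam.le)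
  calc c ^ 2 * ‖u''‖ = c * (c * ‖u''‖) := by ring
    _ ≤ c * ‖W u - h - W' u'‖ := by
      gcongr
      exact mul_le_of_mul_sq_le (norm_nonneg _) (norm_nonneg _) hle
    _ ≤ c * (‖W u‖ + ‖h‖ + ‖W' u'‖) := by
      gcongr
      exact (norm_sub_le _ _).trans (add_le_add_left (norm_sub_le _ _) _)
    _ ≤ c * (‖W‖ * ‖u‖ + ‖h‖ + ‖W'‖ * ‖u'‖) := by
      gcongr <;> exact ContinuousLinearMap.le_opNorm _ _
    _ = c * ‖h‖ + ‖W‖ * (c * ‖u‖) + ‖W'‖ * (c * ‖u'‖) := by ring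
    _ ≤ c * ‖h‖ + ‖W‖ * ‖h‖ + ‖W'‖ * ‖h‖ := by gcongr
    _ = (c + ‖W‖ + ‖W'‖) * ‖h‖ := by ring

/-- Duality: the solution `d` with source `D² k` is paired with the solution with source `d`. -/
theorem IsWeakSol.sq_mul_norm_le [CompleteSpace H] (h𝒟 : IsSkewAdjoint 𝒟)
    (hcomm : HasCommutator 𝒟 W W') (hsymm : (W : H →ₗ[𝕜] H).IsSymmetric) (hc : 0 < c)
    (hW : CoerciveWith W c) (hlam : 0 < lam) {d d' d'' k : H}
    (hd : IsWeakSol 𝒟 W lam d d' d'' 0 k) :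
    c ^ 2 * ‖d‖ ≤ (c + ‖W‖ + ‖W'‖) * ‖k‖ := by
  obtain ⟨U, hU⟩ := exists_isWeakSol h𝒟 hc hW hlam 1 0
  obtain ⟨φ', φ'', hφ⟩ := hU d
  simp only [one_apply_eq_self, zero_apply] at hφ
  set φ := U d
  have hdual : ⟪d, d⟫_𝕜 = ⟪k, φ''⟫_𝕜 := by
    have hsymm' (x y : H) : ⟪W x, y⟫_𝕜 = ⟪x, W y⟫_𝕜 := hsymm x y
    have h₁ := hφ.weak d d' d'' hd.mem hd.mem'
    have h₂ := congrArg (starRingEnd 𝕜) (hd.weak φ φ' φ'' hφ.mem hφ.mem')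
    simp only [map_add, map_mul, inner_conj_symm, RCLike.conj_ofReal, hsymm', inner_zero_right,
      add_zero, zero_add] at h₁ h₂
    rw [← h₁, h₂]
  have hsq : ‖d‖ ^ 2 ≤ ‖k‖ * ‖φ''‖ := by
    rw [← inner_self_eq_norm_sq (𝕜 := 𝕜) d, hdual]
    exact re_inner_le_norm k φ''
  have hφ'' := hφ.sq_mul_norm_deriv_two_le h𝒟 hcomm hc hW hlam
  refine mul_le_of_mul_sq_le (norm_nonneg _) (by positivity) ?_
  calc c ^ 2 * ‖d‖ ^ 2 ≤ c ^ 2 * (‖k‖ * ‖φ''‖) := by gcongr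
    _ = ‖k‖ * (c ^ 2 * ‖φ''‖) := by ring
    _ ≤ ‖k‖ * ((c + ‖W‖ + ‖W'‖) * ‖d‖) := by gcongr
    _ = ‖d‖ * ((c + ‖W‖ + ‖W'‖) * ‖k‖) := by ring

theorem IsSturmLiouvilleSol.exists_deriv_two [CompleteSpace H] (h𝒟 : IsSkewAdjoint 𝒟)
    (hcomm : HasCommutator 𝒟 W W') (hc : 0 < c) (hW : CoerciveWith W c) {u u' f : H}
    (hu : IsSturmLiouvilleSol 𝒟 W W u u' (W f)) :
    ∃ u'', (u', u'') ∈ 𝒟 ∧ W (f - u + u'') = -W' u' := by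
  obtain ⟨u'', hu''⟩ := hcomm.exists_mem_of_map_mem h𝒟 hc hW hu.mem_flux
  refine ⟨u'', hu'', ?_⟩
  have hflux := h𝒟.unique (hcomm u' u'' hu'') hu.mem_flux
  rw [map_add, map_sub, eq_sub_of_add_eq' hflux]
  abel

theorem IsSturmLiouvilleSol.isWeakSol (h𝒟 : IsSkewAdjoint 𝒟) {u u' u'' h : H}
    (hu : IsSturmLiouvilleSol 𝒟 W W u u' h) (hu' : (u', u'') ∈ 𝒟) (lam : ℝ) :
    IsWeakSol 𝒟 W lam u u' u'' h ((lam : 𝕜) • (u'' - u)) where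
  mem := hu.mem
  mem' := hu'
  weak v v' v'' hv hv' := by
    have h₁ := h𝒟.inner_eq_neg hv hu.mem_flux
    have h₂ := h𝒟.inner_eq_neg hv' hu.mem
    simp only [inner_smul_right, inner_sub_right] at *
    linear_combination h₁ + lam * h₂

/-- The difference solves `L_lam d = -lam D² (f - u₀ + u₀'')`, and
`f - u₀ + u₀'' = -W⁻¹ W' u₀'` is bounded in terms of `f`. -/
theorem norm_sub_le_of_isWeakSol [CompleteSpace H] (h𝒟 : IsSkewAdjoint 𝒟)
    (hcomm : HasCommutator 𝒟 W W') (hsymm : (W : H →ₗ[𝕜] H).IsSymmetric) (hc : 0 < c)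
    (hW : CoerciveWith W c) (hlam : 0 < lam) {u u' u'' u₀ u₀' f : H}
    (hu : IsWeakSol 𝒟 W lam u u' u'' (W f) (-(lam : 𝕜) • f))
    (hu₀ : IsSturmLiouvilleSol 𝒟 W W u₀ u₀' (W f)) :
    c ^ 4 * ‖u - u₀‖ ≤ (c + ‖W‖ + ‖W'‖) * (‖W'‖ * ‖W‖) * lam * ‖f‖ := by
  obtain ⟨u₀'', hu₀'', hr⟩ := hu₀.exists_deriv_two h𝒟 hcomm hc hW
  set r := f - u₀ + u₀''
  have hdiff := hu.sub (hu₀.isWeakSol h𝒟 hu₀'' lam)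
  have hsource : -(lam : 𝕜) • f - (lam : 𝕜) • (u₀'' - u₀) = -(lam : 𝕜) • r := by
    simp only [r]
    module
  rw [sub_self, hsource] at hdiff
  have hu₀'_le : c * ‖u₀'‖ ≤ ‖W f‖ :=
    (mul_le_of_energy hc (norm_nonneg _) (norm_nonneg _) (hu₀.energy h𝒟 hW hW)).2
  have hr_le : c * ‖r‖ ≤ ‖W'‖ * ‖u₀'‖ := by
    refine (hW.mul_norm_le r).trans ?_
    rw [hr, norm_neg]
    exact W'.le_opNorm u₀'
  have hr_le' : c ^ 2 * ‖r‖ ≤ ‖W'‖ * ‖W‖ * ‖f‖ :=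
    calc c ^ 2 * ‖r‖ = c * (c * ‖r‖) := by ring
      _ ≤ c * (‖W'‖ * ‖u₀'‖) := by gcongr
      _ = ‖W'‖ * (c * ‖u₀'‖) := by ring
      _ ≤ ‖W'‖ * (‖W‖ * ‖f‖) := by
        gcongr ‖W'‖ * ?_
        exact hu₀'_le.trans (W.le_opNorm f)
      _ = ‖W'‖ * ‖W‖ * ‖f‖ := by ring
  have hd_le := hdiff.sq_mul_norm_le h𝒟 hcomm hsymm hc hW hlam
  rw [norm_smul, norm_neg, RCLike.norm_ofReal, abs_of_pos hlam] at hd_le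
  calc c ^ 4 * ‖u - u₀‖ = c ^ 2 * (c ^ 2 * ‖u - u₀‖) := by ring
    _ ≤ c ^ 2 * ((c + ‖W‖ + ‖W'‖) * (lam * ‖r‖)) := by gcongr
    _ = (c + ‖W‖ + ‖W'‖) * lam * (c ^ 2 * ‖r‖) := by ring
    _ ≤ (c + ‖W‖ + ‖W'‖) * lam * (‖W'‖ * ‖W‖ * ‖f‖) := by gcongr
    _ = (c + ‖W‖ + ‖W'‖) * (‖W'‖ * ‖W‖) * lam * ‖f‖ := by ring

theorem opNorm_sub_le_of_isWeakSol [CompleteSpace H] (h𝒟 : IsSkewAdjoint 𝒟)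
    (hcomm : HasCommutator 𝒟 W W') (hsymm : (W : H →ₗ[𝕜] H).IsSymmetric) (hc : 0 < c)
    (hW : CoerciveWith W c) (hlam : 0 < lam) {R R₀ : H →L[𝕜] H}
    (hR : ∀ f, ∃ u' u'', IsWeakSol 𝒟 W lam (R f) u' u'' (W f) (-(lam : 𝕜) • f))
    (hR₀ : ∀ f, ∃ u', IsSturmLiouvilleSol 𝒟 W W (R₀ f) u' (W f)) :
    ‖R - R₀‖ ≤ (c + ‖W‖ + ‖W'‖) * (‖W'‖ * ‖W‖) / c ^ 4 * lam := by
  refine ContinuousLinearMap.opNorm_le_bound _ (by positivity) fun f => ?_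
  obtain ⟨u', u'', hu⟩ := hR f
  obtain ⟨u₀', hu₀⟩ := hR₀ f
  rw [div_mul_eq_mul_div, div_mul_eq_mul_div, le_div_iff₀' (by positivity)]
  exact norm_sub_le_of_isWeakSol h𝒟 hcomm hsymm hc hW hlam hu hu₀

end SingularPerturbation

section Multiplication

variable {α : Type*} [MeasurableSpace α] {ν : Measure α} {w : α → ℝ} {c : ℝ}

/-- Multiplication by the essentially bounded real function `w`, as an operator in `L²(ν)`: the
weights enter the abstract argument in this form. -/
noncomputable def mulOp (w : α → ℝ) (hw : MemLp w ∞ ν) : Lp ℂ 2 ν →L[ℂ] Lp ℂ 2 ν :=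
  (ContinuousLinearMap.mul ℂ ℂ).holderL ν ∞ 2 2 (hw.ofReal (K := ℂ)).toLp

theorem coeFn_mulOp (hw : MemLp w ∞ ν) (f : Lp ℂ 2 ν) :
    mulOp w hw f =ᵐ[ν] fun x => (w x : ℂ) * f x := by
  filter_upwards [(ContinuousLinearMap.mul ℂ ℂ).coeFn_holder (r := 2) (hw.ofReal (K := ℂ)).toLp f,
    (hw.ofReal (K := ℂ)).coeFn_toLp] with x hmul hx
  refine hmul.trans ?_
  rw [hx]
  rfl

theorem norm_mulOp_le_of_ae_norm_le (hw : MemLp w ∞ ν) (hc : 0 ≤ c) (hwc : ∀ᵐ x ∂ν, ‖w x‖ ≤ c) :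
    ‖mulOp w hw‖ ≤ c := by
  refine ContinuousLinearMap.opNorm_le_bound _ hc fun f => Lp.norm_le_mul_norm_of_ae_le_mul ?_
  filter_upwards [coeFn_mulOp hw f, hwc] with x hx hle
  rw [hx, norm_mul, Complex.norm_real]
  gcongr

theorem norm_mulOp_le (hw : MemLp w ∞ ν) : ‖mulOp w hw‖ ≤ (eLpNorm w ∞ ν).toReal := by
  refine norm_mulOp_le_of_ae_norm_le hw ENNReal.toReal_nonneg ?_
  filter_upwards [ae_le_eLpNormEssSup (f := w) (μ := ν)] with x hx
  rw [← toReal_enorm, eLpNorm_exponent_top]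
  exact ENNReal.toReal_mono (by simpa using hw.2.ne) hx

theorem inner_mulOp (hw : MemLp w ∞ ν) (f g : Lp ℂ 2 ν) :
    ⟪g, mulOp w hw f⟫_ℂ = ∫ x, f x * conj (g x) * (w x : ℂ) ∂ν := by
  rw [L2.inner_def]
  refine integral_congr_ae ?_
  filter_upwards [coeFn_mulOp hw f] with x hx
  rw [hx, RCLike.inner_apply]
  ring

theorem isSymmetric_mulOp (hw : MemLp w ∞ ν) :
    (mulOp w hw : Lp ℂ 2 ν →ₗ[ℂ] Lp ℂ 2 ν).IsSymmetric := fun f g => by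
  change ⟪mulOp w hw f, g⟫_ℂ = ⟪f, mulOp w hw g⟫_ℂ
  rw [← inner_conj_symm, inner_mulOp, inner_mulOp, ← integral_conj]
  simp only [map_mul, Complex.conj_conj, Complex.conj_ofReal, mul_comm (conj _)]

theorem coerciveWith_mulOp (hw : MemLp w ∞ ν) (hc : ∀ᵐ x ∂ν, c ≤ w x) :
    CoerciveWith (mulOp w hw) c := fun f => by
  have hf := L2.integrable_inner (𝕜 := ℂ) f f
  have hwf := L2.integrable_inner (𝕜 := ℂ) f (mulOp w hw f)
  rw [← inner_self_eq_norm_sq (𝕜 := ℂ) f, L2.inner_def, L2.inner_def, ← integral_re hf,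
    ← integral_re hwf, ← integral_const_mul]
  refine integral_mono_ae (hf.re.const_mul c) hwf.re ?_
  filter_upwards [coeFn_mulOp hw f, hc] with x hx hcx
  rw [hx, ← smul_eq_mul (w x : ℂ), inner_smul_right]
  refine le_of_le_of_eq ?_ (RCLike.re_ofReal_mul (w x) _).symm
  exact mul_le_mul_of_nonneg_right hcx inner_self_nonneg

end Multiplication

section WeakDerivative

theorem fourierCoeff_eq_inner (f : L2) (n : ℤ) :
    fourierCoeff f n = ⟪fourierLp 2 n, f⟫_ℂ := by
  rw [← fourierBasis_repr, HilbertBasis.repr_apply_apply, coe_fourierBasis]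

theorem isWeakDeriv_iff_inner {f g : L2} : IsWeakDeriv f g ↔ ∀ n : ℤ,
    ⟪fourierLp 2 n, g⟫_ℂ = Complex.I * n * ⟪fourierLp 2 n, f⟫_ℂ := by
  simp only [IsWeakDeriv, fourierCoeff_eq_inner]

/-- The graph of `D = ∂_θ` in `L²(S¹)`, with domain `H¹(S¹)`: the skew-adjoint relation to which the
abstract estimate is applied. -/
def weakDerivGraph : Submodule ℂ (L2 × L2) where
  carrier := {p | IsWeakDeriv p.1 p.2}
  add_mem' {p q} hp hq := isWeakDeriv_iff_inner.2 fun n => by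
    simp only [Prod.fst_add, Prod.snd_add, inner_add_right, mul_add,
      isWeakDeriv_iff_inner.1 hp n, isWeakDeriv_iff_inner.1 hq n]
  zero_mem' := isWeakDeriv_iff_inner.2 fun n => by simp
  smul_mem' c p hp := isWeakDeriv_iff_inner.2 fun n => by
    simp only [Prod.smul_fst, Prod.smul_snd, inner_smul_right, isWeakDeriv_iff_inner.1 hp n]
    ring

theorem isWeakDeriv_fourierLp (m : ℤ) :
    IsWeakDeriv (fourierLp 2 m : L2) ((Complex.I * m) • fourierLp 2 m : L2) :=
  isWeakDeriv_iff_inner.2 fun n => by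
    have := orthonormal_iff_ite.1 (orthonormal_fourier (T := 2 * Real.pi)) n m
    rw [inner_smul_right, this]
    split_ifs with h
    · rw [h]
    · simp only [mul_zero]

theorem dense_H1 : Dense H1 := by
  have hspan : Dense (Submodule.span ℂ (Set.range (fourierBasis (T := 2 * Real.pi))) : Set L2) :=
    Submodule.dense_iff_topologicalClosure_eq_top.2 fourierBasis.dense_span
  suffices hle : Submodule.span ℂ (Set.range (fourierBasis (T := 2 * Real.pi))) ≤
      weakDerivGraph.map (LinearMap.fst ℂ L2 L2) by
    refine hspan.mono fun f hf => ?_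
    obtain ⟨⟨_, g⟩, hg, rfl⟩ := hle hf
    exact ⟨g, hg⟩
  rw [Submodule.span_le, coe_fourierBasis]
  rintro _ ⟨m, rfl⟩
  exact ⟨(_, _), isWeakDeriv_fourierLp m, rfl⟩

theorem IsWeakDeriv.inner_eq_neg {u u' v v' : L2} (hv : IsWeakDeriv v v') (hu : IsWeakDeriv u u') :
    ⟪v', u⟫_ℂ = -⟪v, u'⟫_ℂ := by
  rw [isWeakDeriv_iff_inner] at hu hv
  rw [← fourierBasis.tsum_inner_mul_inner v' u, ← fourierBasis.tsum_inner_mul_inner v u',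
    ← tsum_neg]
  refine tsum_congr fun n => ?_
  rw [coe_fourierBasis, hu n, ← inner_conj_symm v', hv n, map_mul, inner_conj_symm, map_mul,
    Complex.conj_I, map_intCast]
  ring

theorem isSkewAdjoint_weakDerivGraph : IsSkewAdjoint weakDerivGraph where
  dense_domain := dense_H1
  mem_iff a b := by
    refine ⟨fun hab v v' hv => IsWeakDeriv.inner_eq_neg hv hab, fun h => ?_⟩
    refine isWeakDeriv_iff_inner.2 fun n => ?_
    have := h _ _ (isWeakDeriv_fourierLp n)
    rw [inner_smul_left, map_mul, Complex.conj_I, map_intCast] at this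
    linear_combination this

theorem inner_fourierLp_mulOp {w : S1 → ℝ} (hw : MemLp w ∞ μ) (m n : ℤ) :
    ⟪fourierLp 2 n, mulOp w hw (fourierLp 2 m)⟫_ℂ =
      fourierCoeff (fun θ => (w θ : ℂ)) (n - m) := by
  rw [← fourierCoeff_eq_inner]
  refine integral_congr_ae ?_
  filter_upwards [coeFn_mulOp hw (fourierLp 2 m), coeFn_fourierLp (T := 2 * Real.pi) 2 m]
    with θ hmul hm
  rw [hmul, hm, neg_sub, sub_eq_add_neg, add_comm, fourier_add, smul_eq_mul, smul_eq_mul]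
  ring

theorem isWeakDeriv_mulOp_fourierLp {w w' : S1 → ℝ} (hw : IsW1Infty w w') (m : ℤ) :
    IsWeakDeriv (mulOp w hw.memLp (fourierLp 2 m))
      (mulOp w' hw.memLp_deriv (fourierLp 2 m) +
        (Complex.I * m) • mulOp w hw.memLp (fourierLp 2 m) : L2) :=
  isWeakDeriv_iff_inner.2 fun n => by
    rw [inner_add_right, inner_smul_right, inner_fourierLp_mulOp, inner_fourierLp_mulOp,
      hw.isWeakDeriv]
    push_cast
    ring

/-- By symmetry of the multiplications, the rule for characters yields the weak form of the rule
for any function. -/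
theorem hasCommutator_mulOp {w w' : S1 → ℝ} (hw : IsW1Infty w w') :
    HasCommutator weakDerivGraph (mulOp w hw.memLp) (mulOp w' hw.memLp_deriv) :=
  fun v v' hv => isWeakDeriv_iff_inner.2 fun n => by
    have hsymm (x y : L2) := isSymmetric_mulOp hw.memLp x y
    have hsymm' (x y : L2) := isSymmetric_mulOp hw.memLp_deriv x y
    have hparts := (isWeakDeriv_mulOp_fourierLp hw n).inner_eq_neg hv
    simp only [ContinuousLinearMap.coe_coe] at hsymm hsymm'
    rw [inner_add_left, inner_smul_left, hsymm, hsymm', hsymm, map_mul, Complex.conj_I,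
      map_intCast] at hparts
    rw [inner_add_right]
    linear_combination hparts

end WeakDerivative

section Resolvent

theorem isResolvent_of_dense {T : Set (L2 × L2)} {R : L2 →L[ℂ] L2} {s : Set L2} (hs : Dense s)
    (hinj : ∀ h, R h = 0 → h = 0) (hT : ∀ p ∈ T, R (p.1 + p.2) = p.1)
    (hR : ∀ f ∈ s, (R f, f - R f) ∈ T) : IsResolvent T R := by
  have hcl : ∀ p ∈ closure T, R (p.1 + p.2) = p.1 :=
    closure_minimal hT (isClosed_eq (by fun_prop) (by fun_prop))
  refine ⟨fun h hh => hinj h (by simpa using hcl _ hh), fun f u => ⟨?_, fun h => ?_⟩⟩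
  · rintro rfl
    exact map_mem_closure (f := fun f => (R f, f - R f)) (by fun_prop) (hs f) hR
  · simpa using hcl _ h

variable {w : S1 → ℝ} {c lam : ℝ}

theorem geomInner_eq_conj (hw : MemLp w ∞ μ) (lam : ℝ) (f g : L2) :
    geomInner w lam f g = conj (⟪f, mulOp w hw g⟫_ℂ + lam * ⟪D f, D g⟫_ℂ) := by
  have hsymm : ⟪mulOp w hw g, f⟫_ℂ = ⟪g, mulOp w hw f⟫_ℂ := isSymmetric_mulOp hw g f
  rw [map_add, map_mul, inner_conj_symm, inner_conj_symm, Complex.conj_ofReal, hsymm, inner_mulOp,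
    L2.inner_def]
  rfl

theorem geomInner_eq_geomInner_iff (hw : MemLp w ∞ μ) (f g h k : L2) :
    geomInner w lam f g = geomInner w lam h k ↔
      ⟪f, mulOp w hw g⟫_ℂ + lam * ⟪D f, D g⟫_ℂ = ⟪h, mulOp w hw k⟫_ℂ + lam * ⟪D h, D k⟫_ℂ := by
  rw [geomInner_eq_conj hw, geomInner_eq_conj hw, (starRingEnd ℂ).injective.eq_iff]

theorem mem_laplacianGraph_zero_iff (hw : MemLp w ∞ μ) (u g : L2) :
    (u, g) ∈ laplacianGraph w 0 ↔ ∃ u', IsSturmLiouvilleSol weakDerivGraph (mulOp w hw)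
      (mulOp w hw) u u' (mulOp w hw (u + g)) := by
  simp only [laplacianGraph, adjointGraph, derivationDomain, geomSpace, if_true, Set.mem_univ,
    Set.mem_ofPred_eq, true_and, and_true, geomInner_eq_geomInner_iff hw, Complex.ofReal_zero,
    zero_mul, add_zero]
  have hflux (u' : L2) : (mulOp w hw u', mulOp w hw u - mulOp w hw (u + g)) ∈ weakDerivGraph ↔
      ∀ v v' : L2, IsWeakDeriv v v' → ⟪v', mulOp w hw u'⟫_ℂ = ⟪v, mulOp w hw g⟫_ℂ := by
    rw [isSkewAdjoint_weakDerivGraph.mem_iff, map_add, sub_add_cancel_left]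
    simp only [inner_neg_right, neg_neg]
    rfl
  constructor
  · rintro ⟨hu, hweak⟩
    refine ⟨D u, isWeakDeriv_D hu, (hflux _).2 fun v v' hv => ?_⟩
    rw [← D_eq hv]
    exact hweak v ⟨v', hv⟩
  · rintro ⟨u', hu, hu'⟩
    refine ⟨⟨u', hu⟩, fun v hv => ?_⟩
    rw [D_eq hu]
    exact (hflux u').1 hu' _ _ (isWeakDeriv_D hv)

theorem isWeakSol_add_iff (hw : MemLp w ∞ μ) {u u' u'' g g' : L2} (hu : IsWeakDeriv u u')
    (hu' : IsWeakDeriv u' u'') (hg : IsWeakDeriv g g') :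
    IsWeakSol weakDerivGraph (mulOp w hw) lam u u' u'' (mulOp w hw (u + g))
        (-(lam : ℂ) • (u + g)) ↔
      ∀ v v' v'' : L2, IsWeakDeriv v v' → IsWeakDeriv v' v'' →
        ⟪v', mulOp w hw u'⟫_ℂ + lam * ⟪v'', u''⟫_ℂ = ⟪v, mulOp w hw g⟫_ℂ + lam * ⟪v', g'⟫_ℂ := by
  have hparts {v v' v'' : L2} (hv' : IsWeakDeriv v' v'') :
      ⟪v, mulOp w hw (u + g)⟫_ℂ + ⟪v'', -(lam : ℂ) • (u + g)⟫_ℂ =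
        ⟪v, mulOp w hw u⟫_ℂ + ⟪v, mulOp w hw g⟫_ℂ + lam * ⟪v', u'⟫_ℂ + lam * ⟪v', g'⟫_ℂ := by
    rw [map_add, inner_add_right, inner_smul_right, inner_add_right, hv'.inner_eq_neg hu,
      hv'.inner_eq_neg hg]
    ring
  refine ⟨fun hsol v v' v'' hv hv' => ?_, fun h => ⟨hu, hu', fun v v' v'' hv hv' => ?_⟩⟩
  · have hweak := hsol.weak v v' v'' hv hv'
    rw [hparts hv'] at hweak
    linear_combination hweak
  · rw [hparts hv']
    linear_combination h v v' v'' hv hv'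

theorem mem_laplacianGraph_iff (hw : MemLp w ∞ μ) (hlam : lam ≠ 0) (u g : L2) :
    (u, g) ∈ laplacianGraph w lam ↔ g ∈ H1 ∧ ∃ u' u'', IsWeakSol weakDerivGraph (mulOp w hw) lam
      u u' u'' (mulOp w hw (u + g)) (-(lam : ℂ) • (u + g)) := by
  simp only [laplacianGraph, adjointGraph, derivationDomain, geomSpace, if_neg hlam,
    Set.mem_ofPred_eq, geomInner_eq_geomInner_iff hw]
  constructor
  · rintro ⟨⟨hu, -, hu'⟩, -, hg, hweak⟩
    refine ⟨hg, D u, D (D u), (isWeakSol_add_iff hw (isWeakDeriv_D hu) (isWeakDeriv_D hu')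
      (isWeakDeriv_D hg)).2 fun v v' v'' hv hv' => ?_⟩
    obtain rfl := D_eq hv
    obtain rfl := D_eq hv'
    exact hweak v ⟨⟨_, hv⟩, ⟨_, hv⟩, _, hv'⟩
  · rintro ⟨hg, u', u'', hsol⟩
    have hu : IsWeakDeriv u u' := hsol.mem
    have hu' : IsWeakDeriv u' u'' := hsol.mem'
    obtain rfl := D_eq hu
    obtain rfl := D_eq hu'
    refine ⟨⟨⟨_, hu⟩, ⟨_, hu⟩, _, hu'⟩, ⟨_, hu'⟩, hg, fun v ⟨hv, _, hv'⟩ => ?_⟩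
    exact (isWeakSol_add_iff hw hu hu' (isWeakDeriv_D hg)).1 hsol _ _ _ (isWeakDeriv_D hv)
      (isWeakDeriv_D hv')

theorem isResolvent_laplacianGraph_zero (hw : MemLp w ∞ μ) (hc : 0 < c) (hcw : ∀ᵐ θ ∂μ, c ≤ w θ)
    {R : L2 →L[ℂ] L2} (hR : ∀ f, ∃ u', IsSturmLiouvilleSol weakDerivGraph (mulOp w hw)
      (mulOp w hw) (R f) u' (mulOp w hw f)) :
    IsResolvent (laplacianGraph w 0) R := by
  have h𝒟 := isSkewAdjoint_weakDerivGraph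
  have hW := coerciveWith_mulOp hw hcw
  refine isResolvent_of_dense dense_univ (fun f hf => ?_) (fun p hp => ?_) fun f _ => ?_
  · obtain ⟨u', hmem, hflux⟩ := hR f
    rw [hf] at hmem hflux
    rw [h𝒟.eq_zero_of_mem hmem, map_zero] at hflux
    have hWf : mulOp w hw f = 0 := by simpa using h𝒟.eq_zero_of_mem hflux
    exact hW.injective hc (by rw [hWf, map_zero])
  · obtain ⟨u', hu⟩ := (mem_laplacianGraph_zero_iff hw p.1 p.2).1 hp
    obtain ⟨v', hv⟩ := hR (p.1 + p.2)
    exact hv.unique h𝒟 hc hW hW hu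
  · rw [mem_laplacianGraph_zero_iff hw, add_sub_cancel]
    exact hR f

theorem isResolvent_laplacianGraph (hw : MemLp w ∞ μ) (hc : 0 < c) (hcw : ∀ᵐ θ ∂μ, c ≤ w θ)
    (hlam : 0 < lam) {R : L2 →L[ℂ] L2} (hR : ∀ f, ∃ u' u'', IsWeakSol weakDerivGraph
      (mulOp w hw) lam (R f) u' u'' (mulOp w hw f) (-(lam : ℂ) • f)) :
    IsResolvent (laplacianGraph w lam) R := by
  have hW := coerciveWith_mulOp hw hcw
  refine isResolvent_of_dense dense_H1 (fun f hf => ?_) (fun p hp => ?_) fun f hf => ?_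
  · obtain ⟨u', u'', hu⟩ := hR f
    rw [hf] at hu
    exact hu.source_eq_zero isSkewAdjoint_weakDerivGraph hc hW (isSymmetric_mulOp hw) hlam
  · obtain ⟨-, v', v'', hv⟩ := (mem_laplacianGraph_iff hw hlam.ne' p.1 p.2).1 hp
    obtain ⟨u', u'', hu⟩ := hR (p.1 + p.2)
    exact hu.unique hc hW hlam.le hv
  · rw [mem_laplacianGraph_iff hw hlam.ne', add_sub_cancel]
    obtain ⟨f', hf'⟩ := hf
    obtain ⟨u', _, hu⟩ := hR f
    exact ⟨⟨f' - u', weakDerivGraph.sub_mem (x := (f, f')) hf' hu.mem⟩, hR f⟩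

end Resolvent

end CircleGeometry

theorem theorem7 :
    ∃ C : ℝ → ℝ → ℝ → ℝ,
      ∀ (wm wp : ℝ) (w w' : CircleGeometry.S1 → ℝ),
        0 < wm →
        CircleGeometry.IsW1Infty w w' →
        (∀ᵐ θ ∂CircleGeometry.μ, wm ≤ w θ ∧ w θ ≤ wp) →
        ∃ R₀ : CircleGeometry.L2 →L[ℂ] CircleGeometry.L2,
          CircleGeometry.IsResolvent (CircleGeometry.laplacianGraph w 0) R₀ ∧
          ∀ lam : ℝ, 0 < lam →
            ∃ R : CircleGeometry.L2 →L[ℂ] CircleGeometry.L2,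
              CircleGeometry.IsResolvent (CircleGeometry.laplacianGraph w lam) R ∧
              ‖R - R₀‖ ≤ C wm wp (eLpNorm w' ∞ CircleGeometry.μ).toReal * lam := by
  open CircleGeometry in
  refine ⟨fun a b M => (a + b + M) * (M * b) / a ^ 4, fun wm wp w w' hwm hw hbd => ?_⟩
  have hlow : ∀ᵐ θ ∂μ, wm ≤ w θ := hbd.mono fun _ h => h.1
  have hup : ∀ᵐ θ ∂μ, ‖w θ‖ ≤ wp := hbd.mono fun _ h => abs_le.2 ⟨by linarith, h.2⟩
  have hwp : 0 ≤ wp := hup.exists.elim fun θ h => (norm_nonneg _).trans h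
  have hW := coerciveWith_mulOp hw.memLp hlow
  have hW_le := norm_mulOp_le_of_ae_norm_le hw.memLp hwp hup
  have hW'_le := norm_mulOp_le hw.memLp_deriv
  have h𝒟 := isSkewAdjoint_weakDerivGraph
  obtain ⟨A, hA⟩ := exists_isSturmLiouvilleSol h𝒟 hwm hW hW
  have hR₀ (f : L2) := hA (mulOp w hw.memLp f)
  refine ⟨A ∘L mulOp w hw.memLp, isResolvent_laplacianGraph_zero hw.memLp hwm hlow hR₀,
    fun lam hlam => ?_⟩
  obtain ⟨R, hR⟩ := exists_isWeakSol h𝒟 hwm hW hlam (mulOp w hw.memLp) (-(lam : ℂ) • 1)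
  refine ⟨R, isResolvent_laplacianGraph hw.memLp hwm hlow hlam hR,
    (opNorm_sub_le_of_isWeakSol h𝒟 (hasCommutator_mulOp hw) (isSymmetric_mulOp _) hwm hW
      hlam hR hR₀).trans ?_⟩
  beta_reduce
  gcongr
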